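/- Let $\Omega=\{(x,y)\in\mathbb{R}^2 : 0<x<1,\ 0<y<1\}$ with Lebesgue measure, and let $\alpha_1,\alpha_2\in(0,\tfrac12)$. Let $\mathcal{H}^1(\Omega)$ be the space of real functions $u\in L^2(\Omega)$ whose weak derivatives $\partial_x u,\partial_y u$ satisfy $y^{\alpha_1}\partial_x u\in L^2(\Omega)$ and $x^{\alpha_2}\partial_y u\in L^2(\Omega)$, with the norm $$\|u\|_{\mathcal{H}^1(\Omega)}=\Big(\|u\|_{L^2(\Omega)}^2+\|y^{\alpha_1}\partial_x u\|_{L^2(\Omega)}^2+\|x^{\alpha_2}\partial_y u\|_{L^2(\Omega)}^2\Big)^{1/2},$$ and let $\mathcal{H}_0^1(\Omega)$ be the closure of $C_0^\infty(\Omega)$ (smooth functions with compact support in $\Omega$) in $\mathcal{H}^1(\Omega)$, with the same norm. Then, for every real $m\in[1,4)$, the space $\mathcal{H}_0^1(\Omega)$ is compactly embedded in $L^m(\Omega)$: every $u\in\mathcal{H}_0^1(\Omega)$ belongs to $L^m(\Omega)$, and the inclusion map $\mathcal{H}_0^1(\Omega)\to L^m(\Omega)$ is an injective, continuous, compact linear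 operator. -/

import Mathlib

open MeasureTheory Set
open scoped ENNReal ContDiff

noncomputable section

namespace WeightedSquare

/-- The open unit square `Ω = {(x, y) : 0 < x < 1, 0 < y < 1}`. -/
def Ω : TopologicalSpace.Opens (ℝ × ℝ) :=
  ⟨Ioo (0 : ℝ) 1 ×ˢ Ioo (0 : ℝ) 1, isOpen_Ioo.prod isOpen_Ioo⟩

/-- Two-dimensional Lebesgue measure on `Ω`. -/
abbrev μΩ : Measure (ℝ × ℝ) := (volume : Measure (ℝ × ℝ)).restrict (Ω : Set (ℝ × ℝ))

/-- The real Lebesgue space `L²(Ω)`. -/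
abbrev L2 : Type := Lp ℝ 2 μΩ

/-- The test functions `C₀^∞(Ω)`: smooth real functions with compact support contained in `Ω`. -/
abbrev CcInfty : Type := TestFunction Ω ℝ (⊤ : ℕ∞)

/-- `g` is the weak (distributional) derivative of `u` in the direction `e` on `Ω`. -/
structure IsWeakDeriv (e : ℝ × ℝ) (u g : ℝ × ℝ → ℝ) : Prop where
  locallyIntegrable_fun : LocallyIntegrableOn u Ω
  locallyIntegrable_deriv : LocallyIntegrableOn g Ω
  integral_eq : ∀ φ : CcInfty,
    ∫ z in (Ω : Set (ℝ × ℝ)), u z * fderiv ℝ φ z e = - ∫ z in (Ω : Set (ℝ × ℝ)), g z * φ z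

theorem integrable_mul_of_locallyIntegrableOn {u ψ : ℝ × ℝ → ℝ} (hu : LocallyIntegrableOn u Ω)
    (hψ : Continuous ψ) (hc : HasCompactSupport ψ) (hs : tsupport ψ ⊆ Ω) :
    IntegrableOn (fun z => u z * ψ z) Ω := by
  have h1 : IntegrableOn (fun z => u z * ψ z) (tsupport ψ) :=
    (hu.integrableOn_compact_subset hs hc).mul_continuousOn hψ.continuousOn hc
  refine IntegrableOn.mono_set ?_ (subset_univ _)
  rw [integrableOn_univ]
  refine (integrableOn_iff_integrable_of_support_subset ?_).1 h1
  intro z hz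
  exact subset_tsupport ψ (fun h => hz (by simp [h]))

theorem integrable_mul_test {u : ℝ × ℝ → ℝ} (hu : LocallyIntegrableOn u Ω) (φ : CcInfty) :
    IntegrableOn (fun z => u z * φ z) Ω :=
  integrable_mul_of_locallyIntegrableOn hu φ.continuous φ.hasCompactSupport φ.tsupport_subset

theorem continuous_fderiv_test (φ : CcInfty) (e : ℝ × ℝ) :
    Continuous (fun z => fderiv ℝ φ z e) := by
  have h : ContDiff ℝ ∞ φ := φ.contDiff
  exact (h.continuous_fderiv (by simp)).clm_apply continuous_const

theorem hasCompactSupport_fderiv_test (φ : CcInfty) (e : ℝ × ℝ) :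
    HasCompactSupport (fun z => fderiv ℝ φ z e) :=
  φ.hasCompactSupport.fderiv_apply ℝ e

theorem tsupport_fderiv_test (φ : CcInfty) (e : ℝ × ℝ) :
    tsupport (fun z => fderiv ℝ φ z e) ⊆ Ω :=
  (tsupport_fderiv_apply_subset ℝ e).trans φ.tsupport_subset

theorem integrable_mul_fderiv_test {u : ℝ × ℝ → ℝ} (hu : LocallyIntegrableOn u Ω) (φ : CcInfty)
    (e : ℝ × ℝ) : IntegrableOn (fun z => u z * fderiv ℝ φ z e) Ω :=
  integrable_mul_of_locallyIntegrableOn hu (continuous_fderiv_test φ e)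
    (hasCompactSupport_fderiv_test φ e) (tsupport_fderiv_test φ e)

instance isFiniteMeasure_μΩ : IsFiniteMeasure μΩ := by
  refine ⟨?_⟩
  rw [Measure.restrict_apply_univ]
  refine lt_of_le_of_lt (measure_mono (?_ : _ ⊆ Icc (0 : ℝ × ℝ) 1)) isCompact_Icc.measure_lt_top
  rintro ⟨x, y⟩ ⟨⟨h1, h2⟩, h3, h4⟩
  exact ⟨⟨h1.le, h3.le⟩, ⟨h2.le, h4.le⟩⟩

theorem locallyIntegrableOn_L2 (u : L2) : LocallyIntegrableOn u Ω :=
  IntegrableOn.locallyIntegrableOn ((Lp.memLp u).integrable one_le_two)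

theorem IsWeakDeriv.congr {e : ℝ × ℝ} {u u' g : ℝ × ℝ → ℝ} (h : IsWeakDeriv e u g)
    (hu' : LocallyIntegrableOn u' Ω) (huu : u =ᵐ[μΩ] u') : IsWeakDeriv e u' g := by
  refine ⟨hu', h.2, fun φ => ?_⟩
  rw [← h.3 φ]
  refine integral_congr_ae ?_
  filter_upwards [huu] with z hz
  rw [hz]

theorem isWeakDeriv_zero (e : ℝ × ℝ) : IsWeakDeriv e 0 0 :=
  ⟨locallyIntegrableOn_zero, locallyIntegrableOn_zero, fun φ => by simp⟩

theorem IsWeakDeriv.add {e : ℝ × ℝ} {u v g h : ℝ × ℝ → ℝ} (hu : IsWeakDeriv e u g)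
    (hv : IsWeakDeriv e v h) : IsWeakDeriv e (u + v) (g + h) := by
  refine ⟨hu.1.add hv.1, hu.2.add hv.2, fun φ => ?_⟩
  simp only [Pi.add_apply, add_mul]
  rw [integral_add (integrable_mul_fderiv_test hu.1 φ e) (integrable_mul_fderiv_test hv.1 φ e),
    integral_add (integrable_mul_test hu.2 φ) (integrable_mul_test hv.2 φ), hu.3, hv.3]
  ring

theorem IsWeakDeriv.smul {e : ℝ × ℝ} {u g : ℝ × ℝ → ℝ} (c : ℝ) (hu : IsWeakDeriv e u g) :
    IsWeakDeriv e (c • u) (c • g) := by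
  refine ⟨hu.1.smul c, hu.2.smul c, fun φ => ?_⟩
  simp only [Pi.smul_apply, smul_eq_mul, mul_assoc]
  rw [integral_const_mul, integral_const_mul, hu.3]
  ring

/-- The space `𝓗¹(Ω)` of all `u ∈ L²(Ω)` whose weak derivatives `∂ₓu`, `∂_y u` satisfy
`y^α₁ ∂ₓu ∈ L²(Ω)` and `x^α₂ ∂_y u ∈ L²(Ω)`. An element `u` is stored as the triple
`(u, y^α₁ ∂ₓu, x^α₂ ∂_y u)` of elements of `L²(Ω)` (by `H1.toL2_injective` below it is determined
by `u`); the norm and the scalar product inherited from the Hilbert space sum `L² ⊕ L² ⊕ L²` are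
`‖u‖² = ‖u‖²_{L²} + ‖y^α₁ ∂ₓu‖²_{L²} + ‖x^α₂ ∂_y u‖²_{L²}` and its polarization. -/
def H1 (α₁ α₂ : ℝ) : Submodule ℝ (PiLp 2 (fun _ : Fin 3 => L2)) where
  carrier := {U | ∃ g h : ℝ × ℝ → ℝ,
    IsWeakDeriv (1, 0) (U 0) g ∧ IsWeakDeriv (0, 1) (U 0) h ∧
    U 1 =ᵐ[μΩ] (fun z => z.2 ^ α₁ * g z) ∧ U 2 =ᵐ[μΩ] (fun z => z.1 ^ α₂ * h z)}
  zero_mem' := by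
    have h0 : ((0 : ℝ × ℝ → ℝ)) =ᵐ[μΩ] ((0 : L2) : ℝ × ℝ → ℝ) := (Lp.coeFn_zero ℝ 2 μΩ).symm
    refine ⟨0, 0, (isWeakDeriv_zero _).congr (locallyIntegrableOn_L2 0) h0,
      (isWeakDeriv_zero _).congr (locallyIntegrableOn_L2 0) h0, ?_, ?_⟩ <;>
    · refine h0.symm.trans (ae_of_all _ fun z => ?_)
      simp
  add_mem' := by
    rintro U V ⟨g, h, hg, hh, h1, h2⟩ ⟨g', h', hg', hh', h1', h2'⟩
    have ha : ∀ i, ((U i : L2) : ℝ × ℝ → ℝ) + ((V i : L2) : ℝ × ℝ → ℝ) =ᵐ[μΩ]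
        ((U + V) i : L2) :=
      fun i => (Lp.coeFn_add (U i) (V i)).symm
    refine ⟨g + g', h + h', (hg.add hg').congr (locallyIntegrableOn_L2 _) (ha 0),
      (hh.add hh').congr (locallyIntegrableOn_L2 _) (ha 0), ?_, ?_⟩
    · filter_upwards [h1, h1', ha 1] with z a b c
      rw [← c, Pi.add_apply, Pi.add_apply, a, b, mul_add]
    · filter_upwards [h2, h2', ha 2] with z a b c
      rw [← c, Pi.add_apply, Pi.add_apply, a, b, mul_add]
  smul_mem' := by
    rintro c U ⟨g, h, hg, hh, h1, h2⟩
    have ha : ∀ i, c • ((U i : L2) : ℝ × ℝ → ℝ) =ᵐ[μΩ] ((c • U) i : L2) :=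
      fun i => (Lp.coeFn_smul c (U i)).symm
    refine ⟨c • g, c • h, (hg.smul c).congr (locallyIntegrableOn_L2 _) (ha 0),
      (hh.smul c).congr (locallyIntegrableOn_L2 _) (ha 0), ?_, ?_⟩
    · filter_upwards [h1, ha 1] with z a b
      rw [← b, Pi.smul_apply, Pi.smul_apply, a, smul_eq_mul, smul_eq_mul, mul_left_comm]
    · filter_upwards [h2, ha 2] with z a b
      rw [← b, Pi.smul_apply, Pi.smul_apply, a, smul_eq_mul, smul_eq_mul, mul_left_comm]

/-- The function `u ∈ L²(Ω)` underlying an element of `𝓗¹(Ω)`. -/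
def H1.toL2 {α₁ α₂ : ℝ} (U : H1 α₁ α₂) : L2 := (U : PiLp 2 (fun _ : Fin 3 => L2)) 0

theorem IsWeakDeriv.ae_eq {e : ℝ × ℝ} {u g h : ℝ × ℝ → ℝ} (hg : IsWeakDeriv e u g)
    (hh : IsWeakDeriv e u h) : g =ᵐ[μΩ] h := by
  have key := Ω.isOpen.ae_eq_zero_of_integral_contDiff_smul_eq_zero (μ := volume)
    (f := g - h) (hg.2.sub hh.2) (fun ψ h1 h2 h3 => by
      have e1 := hg.3 ⟨ψ, h1, h2, h3⟩
      have e2 := hh.3 ⟨ψ, h1, h2, h3⟩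
      have i1 := integrable_mul_test hg.2 ⟨ψ, h1, h2, h3⟩
      have i2 := integrable_mul_test hh.2 ⟨ψ, h1, h2, h3⟩
      have e3 := neg_injective (e1.symm.trans e2)
      rw [← setIntegral_eq_integral_of_forall_compl_eq_zero (s := (Ω : Set (ℝ × ℝ)))]
      · simp only [Pi.sub_apply, smul_eq_mul, mul_sub]
        rw [integral_sub (by simpa [mul_comm, IntegrableOn] using i1)
          (by simpa [mul_comm, IntegrableOn] using i2), sub_eq_zero]
        simpa [mul_comm] using e3
      · intro z hz
        have : ψ z = 0 := image_eq_zero_of_notMem_tsupport (fun h => hz (h3 h))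
        simp [this])
  refine (ae_restrict_iff' Ω.isOpen.measurableSet).2 ?_
  filter_upwards [key] with z hz hzΩ
  exact sub_eq_zero.1 (hz hzΩ)

/-- An element of `𝓗¹(Ω)` is determined by its underlying function. -/
theorem H1.toL2_injective {α₁ α₂ : ℝ} :
    Function.Injective (H1.toL2 : H1 α₁ α₂ → L2) := by
  rintro ⟨U, g, h, hg, hh, h1, h2⟩ ⟨V, g', h', hg', hh', h1', h2'⟩ huv
  have h0 : U 0 = V 0 := huv
  rw [← h0] at hg' hh'
  refine Subtype.ext (PiLp.ext fun i => ?_)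
  fin_cases i
  · exact h0
  · refine Lp.ext (h1.trans (Filter.EventuallyEq.trans ?_ h1'.symm))
    filter_upwards [hg.ae_eq hg'] with z hz
    rw [hz]
  · refine Lp.ext (h2.trans (Filter.EventuallyEq.trans ?_ h2'.symm))
    filter_upwards [hh.ae_eq hh'] with z hz
    rw [hz]

/-- `C₀^∞(Ω)` as a linear subspace of `𝓗¹(Ω)`. -/
def smoothCompact (α₁ α₂ : ℝ) : Submodule ℝ (H1 α₁ α₂) where
  carrier := {U | ∃ φ : CcInfty, H1.toL2 U =ᵐ[μΩ] φ}
  zero_mem' := ⟨0, Lp.coeFn_zero ℝ 2 μΩ⟩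
  add_mem' := by
    rintro U V ⟨φ, hφ⟩ ⟨ψ, hψ⟩
    exact ⟨φ + ψ, (Lp.coeFn_add (H1.toL2 U) (H1.toL2 V)).trans (hφ.add hψ)⟩
  smul_mem' := by
    rintro c U ⟨φ, hφ⟩
    exact ⟨c • φ, (Lp.coeFn_smul c (H1.toL2 U)).trans (hφ.const_smul c)⟩

/-- Every test function belongs to `𝓗¹(Ω)` (for nonnegative exponents), so that
`smoothCompact` is all of `C₀^∞(Ω)`. -/
theorem exists_mem_smoothCompact {α₁ α₂ : ℝ} (h₁ : 0 ≤ α₁) (h₂ : 0 ≤ α₂) (φ : CcInfty) :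
    ∃ U ∈ smoothCompact α₁ α₂, H1.toL2 U =ᵐ[μΩ] φ := by
  have hd (e : ℝ × ℝ) : IsWeakDeriv e φ (fun z => fderiv ℝ φ z e) := by
    have hcd : ContDiff ℝ ∞ φ := φ.contDiff
    have l1 : LocallyIntegrable φ (volume : Measure (ℝ × ℝ)) := φ.continuous.locallyIntegrable
    have l2 : LocallyIntegrable (fun z => fderiv ℝ φ z e) (volume : Measure (ℝ × ℝ)) :=
      (continuous_fderiv_test φ e).locallyIntegrable
    refine ⟨l1.locallyIntegrableOn _, l2.locallyIntegrableOn _, fun ψ => ?_⟩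
    have hψ : ContDiff ℝ ∞ ψ := ψ.contDiff
    rw [setIntegral_eq_integral_of_forall_compl_eq_zero,
      setIntegral_eq_integral_of_forall_compl_eq_zero]
    · refine integral_mul_fderiv_eq_neg_fderiv_mul_of_integrable ?_ ?_ ?_
        (fun z _ => hcd.differentiable (by simp) z) (fun z _ => hψ.differentiable (by simp) z)
      · exact ((continuous_fderiv_test φ e).mul ψ.continuous).integrable_of_hasCompactSupport
          ψ.hasCompactSupport.mul_left
      · exact (φ.continuous.mul (continuous_fderiv_test ψ e)).integrable_of_hasCompactSupport
          φ.hasCompactSupport.mul_right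
      · exact (φ.continuous.mul ψ.continuous).integrable_of_hasCompactSupport
          φ.hasCompactSupport.mul_right
    · intro z hz
      have : ψ z = 0 := image_eq_zero_of_notMem_tsupport (fun h => hz (ψ.tsupport_subset h))
      simp [this]
    · intro z hz
      have : φ z = 0 := image_eq_zero_of_notMem_tsupport (fun h => hz (φ.tsupport_subset h))
      simp [this]
  have m0 : MemLp φ 2 μΩ := φ.continuous.memLp_of_hasCompactSupport φ.hasCompactSupport
  have m1 : MemLp (fun z : ℝ × ℝ => z.2 ^ α₁ * fderiv ℝ φ z (1, 0)) 2 μΩ :=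
    ((continuous_snd.rpow_const fun _ => Or.inr h₁).mul
      (continuous_fderiv_test φ _)).memLp_of_hasCompactSupport
      (hasCompactSupport_fderiv_test φ _).mul_left
  have m2 : MemLp (fun z : ℝ × ℝ => z.1 ^ α₂ * fderiv ℝ φ z (0, 1)) 2 μΩ :=
    ((continuous_fst.rpow_const fun _ => Or.inr h₂).mul
      (continuous_fderiv_test φ _)).memLp_of_hasCompactSupport
      (hasCompactSupport_fderiv_test φ _).mul_left
  refine ⟨⟨WithLp.toLp 2 ![m0.toLp, m1.toLp, m2.toLp], _, _,
    (hd (1, 0)).congr (locallyIntegrableOn_L2 _) m0.coeFn_toLp.symm,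
    (hd (0, 1)).congr (locallyIntegrableOn_L2 _) m0.coeFn_toLp.symm,
    m1.coeFn_toLp, m2.coeFn_toLp⟩, ⟨φ, m0.coeFn_toLp⟩, m0.coeFn_toLp⟩

/-- `𝓗₀¹(Ω)`: the closure of `C₀^∞(Ω)` in `𝓗¹(Ω)`, with the norm of `𝓗¹(Ω)`. -/
def H01 (α₁ α₂ : ℝ) : Submodule ℝ (H1 α₁ α₂) := (smoothCompact α₁ α₂).topologicalClosure

/-- The function `u ∈ L²(Ω)` underlying an element of `𝓗₀¹(Ω)`. -/
def H01.toL2 {α₁ α₂ : ℝ} (U : H01 α₁ α₂) : L2 := H1.toL2 (U : H1 α₁ α₂)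

end WeightedSquare

end

/-!
The proof rests on two a priori estimates for test functions `φ`, both carried to `𝓗₀¹(Ω)` by
density (`H01.induction_on_test`, with Fatou's lemma in `isClosed_eLpNorm_toL2_le`).

*Critical integrability.* Since `t ≤ t ^ (2α)` on `(0, 1)` for `α ≤ 1/2`, the norm of `𝓗¹(Ω)`
dominates the critical energy `E = ∫ y |∂ₓφ|² + ∫ x |∂_yφ|²`. Below the diagonal one integrates
`∂_yφ` from the bottom side, above it `∂ₓφ` from the left side; this gives the Hardy-type bound
`∫ φ² / min(x, y) ≤ E` (`lintegral_sq_div_min_le_critEnergy`). The planar Gagliardo–Nirenberg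
inequality for `φ²` bounds `∫ φ⁴` by a multiple of `(∫ |φ| |∇φ|)²`, and
`|φ| |∂ₓφ| ≤ φ² / y + y |∂ₓφ|²`, together with its mirror image, bounds the right-hand side by a
multiple of `E²` (`exists_lintegral_pow_four_le`). Hence `𝓗₀¹(Ω)` embeds continuously in `L⁴(Ω)`.

*Compactness in `L¹`.* Because `α < 1/2`, the dual weight `t ^ (-α)` is square integrable, so by
Cauchy–Schwarz the gradient is controlled in `L¹(Ω)` (`exists_lintegral_gradient_le`). The `L¹`
Poincaré inequality on squares of side `1 / n` then shows that replacing a function by its averages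
over these squares costs at most a multiple of `1 / n` times its norm
(`exists_norm_sub_cellAverageCLM_le`). The inclusion into `L¹(Ω)` is therefore an operator-norm
limit of operators of finite rank.

Finally, `‖u‖_m` is bounded by interpolation between `‖u‖₁` and `‖u‖₄`, with a positive power of
`‖u‖₁` when `m < 4`, which transfers compactness from `L¹` to `L^m`
(`isCompactOperator_of_interpolation`).
-/

namespace WeightedSquare

/-! ### Weighted inequalities for functions on the square -/

/-- Lebesgue measure on the unit interval. -/
noncomputable abbrev unitMeasure : Measure ℝ := (volume : Measure ℝ).restrict (Ioo (0 : ℝ) 1)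

theorem μΩ_eq_prod : μΩ = unitMeasure.prod unitMeasure := by
  rw [unitMeasure, Measure.prod_restrict, ← Measure.volume_eq_prod]
  rfl

/-- The Cauchy–Schwarz inequality, squared so that it involves natural powers only. -/
theorem sq_lintegral_mul_le {X : Type*} [MeasurableSpace X] {μ : Measure X} {f g : X → ℝ≥0∞}
    (hf : AEMeasurable f μ) (hg : AEMeasurable g μ) :
    (∫⁻ a, f a * g a ∂μ) ^ 2 ≤ (∫⁻ a, f a ^ 2 ∂μ) * ∫⁻ a, g a ^ 2 ∂μ := by
  have h := ENNReal.lintegral_mul_norm_pow_le (hf.pow_const 2) (hg.pow_const 2)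
    (p := 1 / 2) (q := 1 / 2) (by norm_num) (by norm_num) (by norm_num)
  have e (x : ℝ≥0∞) : (x ^ 2) ^ (1 / 2 : ℝ) = x := by
    rw [← ENNReal.rpow_natCast, ← ENNReal.rpow_mul]; norm_num
  have e' (x : ℝ≥0∞) : (x ^ (1 / 2 : ℝ)) ^ 2 = x := by
    rw [← ENNReal.rpow_natCast, ← ENNReal.rpow_mul]; norm_num
  simp only [e] at h
  calc _ ≤ _ := pow_le_pow_left' h 2
    _ = _ := by rw [mul_pow, e', e']

theorem sq_enorm_le_mul_lintegral_deriv {ψ : ℝ → ℝ} (hψ : ContDiff ℝ 1 ψ) (h0 : ψ 0 = 0) {t : ℝ}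
    (ht : t ∈ Ioo (0 : ℝ) 1) :
    ‖ψ t‖ₑ ^ 2 ≤ ENNReal.ofReal t * ∫⁻ s, ‖deriv ψ s‖ₑ ^ 2 ∂unitMeasure := by
  have h1 := enorm_sub_le_lintegral_deriv_of_contDiffOn_Icc (hψ.contDiffOn (s := Icc 0 t)) ht.1.le
  rw [h0, sub_zero] at h1
  have hm : Measurable fun s => ‖deriv ψ s‖ₑ := (hψ.continuous_deriv le_rfl).measurable.enorm
  have h2 := sq_lintegral_mul_le (μ := volume.restrict (Icc 0 t)) (f := fun _ => 1)
    aemeasurable_const hm.aemeasurable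
  simp only [one_mul, one_pow, lintegral_const, Measure.restrict_apply_univ, Real.volume_Icc,
    sub_zero] at h2
  refine (pow_le_pow_left' h1 2).trans (h2.trans ?_)
  gcongr
  rw [← restrict_Ioo_eq_restrict_Icc]
  exact Measure.restrict_mono (Ioo_subset_Ioo_right ht.2.le) le_rfl

theorem deriv_slice_fst {φ : ℝ × ℝ → ℝ} (hφ : ContDiff ℝ 1 φ) (x y : ℝ) :
    deriv (fun t => φ (t, y)) x = fderiv ℝ φ (x, y) (1, 0) := by
  have h := (hφ.differentiable (by simp) (x, y)).hasFDerivAt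
  exact (h.comp_hasDerivAt x ((hasDerivAt_id x).prodMk (hasDerivAt_const x y))).deriv

theorem deriv_slice_snd {φ : ℝ × ℝ → ℝ} (hφ : ContDiff ℝ 1 φ) (x y : ℝ) :
    deriv (fun t => φ (x, t)) y = fderiv ℝ φ (x, y) (0, 1) := by
  have h := (hφ.differentiable (by simp) (x, y)).hasFDerivAt
  exact (h.comp_hasDerivAt y ((hasDerivAt_const y x).prodMk (hasDerivAt_id y))).deriv

theorem measurable_enorm_fderiv {φ : ℝ × ℝ → ℝ} (hφ : ContDiff ℝ 1 φ) (e : ℝ × ℝ) :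
    Measurable fun z => ‖fderiv ℝ φ z e‖ₑ :=
  ((hφ.continuous_fderiv (by simp)).clm_apply continuous_const).measurable.enorm

/-- The degenerate Dirichlet energy `∫ y |∂ₓφ|² + ∫ x |∂_yφ|²`, with both exponents at the critical
value `1/2`. -/
noncomputable def critEnergy (φ : ℝ × ℝ → ℝ) : ℝ≥0∞ :=
  (∫⁻ z, ENNReal.ofReal z.2 * ‖fderiv ℝ φ z (1, 0)‖ₑ ^ 2 ∂μΩ) +
    ∫⁻ z, ENNReal.ofReal z.1 * ‖fderiv ℝ φ z (0, 1)‖ₑ ^ 2 ∂μΩ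

/-- A Hardy-type inequality: below the diagonal `φ²` is bounded by `y` times the integral of
`|∂_yφ|²` over the vertical line, above it by `x` times that of `|∂ₓφ|²` over the horizontal line,
and the half-line cut out by the diagonal has length `x`, respectively `y`. -/
theorem lintegral_sq_div_min_le_critEnergy {φ : ℝ × ℝ → ℝ} (hφ : ContDiff ℝ 1 φ)
    (h0 : ∀ z ∉ (Ω : Set (ℝ × ℝ)), φ z = 0) :
    ∫⁻ z, ‖φ z‖ₑ ^ 2 / ENNReal.ofReal (min z.1 z.2) ∂μΩ ≤ critEnergy φ := by
  set a : ℝ → ℝ≥0∞ := fun y => ∫⁻ x, ‖fderiv ℝ φ (x, y) (1, 0)‖ₑ ^ 2 ∂unitMeasure with ha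
  set b : ℝ → ℝ≥0∞ := fun x => ∫⁻ y, ‖fderiv ℝ φ (x, y) (0, 1)‖ₑ ^ 2 ∂unitMeasure with hb
  have hma : Measurable a := ((measurable_enorm_fderiv hφ (1, 0)).pow_const 2).lintegral_prod_left'
  have hmb : Measurable b := ((measurable_enorm_fderiv hφ (0, 1)).pow_const 2).lintegral_prod_right'
  have hS : MeasurableSet {z : ℝ × ℝ | z.2 ≤ z.1} := measurableSet_le measurable_snd measurable_fst
  have hT : MeasurableSet {z : ℝ × ℝ | z.1 ≤ z.2} := measurableSet_le measurable_fst measurable_snd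
  have hz0 (t : ℝ) : (0, t) ∉ (Ω : Set (ℝ × ℝ)) := fun h => lt_irrefl _ h.1.1
  have hz1 (t : ℝ) : (t, 0) ∉ (Ω : Set (ℝ × ℝ)) := fun h => lt_irrefl _ h.2.1
  have key : ∀ᵐ z ∂μΩ, ‖φ z‖ₑ ^ 2 / ENNReal.ofReal (min z.1 z.2) ≤
      {z : ℝ × ℝ | z.1 ≤ z.2}.indicator (fun z => a z.2) z +
        {z : ℝ × ℝ | z.2 ≤ z.1}.indicator (fun z => b z.1) z := by
    filter_upwards [self_mem_ae_restrict Ω.isOpen.measurableSet] with ⟨x, y⟩ hz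
    obtain ⟨hx, hy⟩ : x ∈ Ioo (0 : ℝ) 1 ∧ y ∈ Ioo (0 : ℝ) 1 := hz
    rcases le_total x y with h | h
    · have := sq_enorm_le_mul_lintegral_deriv (ψ := fun t => φ (t, y))
        (hφ.comp (by fun_prop)) (h0 _ (hz0 y)) hx
      simp only [deriv_slice_fst hφ] at this
      refine le_add_right ?_
      rw [indicator_of_mem (by exact h), min_eq_left h]
      exact ENNReal.div_le_of_le_mul (by rwa [mul_comm])
    · have := sq_enorm_le_mul_lintegral_deriv (ψ := fun t => φ (x, t))
        (hφ.comp (by fun_prop)) (h0 _ (hz1 x)) hy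
      simp only [deriv_slice_snd hφ] at this
      refine le_add_left ?_
      rw [indicator_of_mem (by exact h), min_eq_right h]
      exact ENNReal.div_le_of_le_mul (by rwa [mul_comm])
  refine (lintegral_mono_ae key).trans ?_
  have hma' : Measurable ({z : ℝ × ℝ | z.1 ≤ z.2}.indicator (fun z => a z.2)) :=
    (hma.comp measurable_snd).indicator hT
  have hmb' : Measurable ({z : ℝ × ℝ | z.2 ≤ z.1}.indicator (fun z => b z.1)) :=
    (hmb.comp measurable_fst).indicator hS
  -- The half-line cut out by the diagonal has length at most `t` inside the unit interval.
  have hlen (t : ℝ) (c : ℝ≥0∞) :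
      ∫⁻ s, (Iic t).indicator (fun _ => c) s ∂unitMeasure ≤ ENNReal.ofReal t * c := by
    rw [lintegral_indicator_const measurableSet_Iic, Measure.restrict_apply measurableSet_Iic,
      mul_comm]
    gcongr
    calc volume (Iic t ∩ Ioo 0 1) ≤ volume (Icc 0 t) := measure_mono fun s hs => ⟨hs.2.1.le, hs.1⟩
      _ = _ := by simp
  rw [lintegral_add_left hma', critEnergy, μΩ_eq_prod]
  refine add_le_add ?_ ?_
  · rw [lintegral_prod_symm' _ hma', lintegral_prod_symm']
    · refine lintegral_mono fun y => ?_
      dsimp only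
      rw [lintegral_const_mul' _ _ ENNReal.ofReal_ne_top]
      exact hlen y (a y)
    · exact (ENNReal.measurable_ofReal.comp measurable_snd).mul
        ((measurable_enorm_fderiv hφ (1, 0)).pow_const 2)
  · rw [lintegral_prod _ hmb'.aemeasurable, lintegral_prod]
    · refine lintegral_mono fun x => ?_
      dsimp only
      rw [lintegral_const_mul' _ _ ENNReal.ofReal_ne_top]
      exact hlen x (b x)
    · exact ((ENNReal.measurable_ofReal.comp measurable_fst).mul
        ((measurable_enorm_fderiv hφ (0, 1)).pow_const 2)).aemeasurable

/-- The weighted inequality `ab ≤ a² / c + c b²`, in which `c` may be decreased to `d` in the first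
term. -/
theorem mul_le_sq_div_add_mul_sq {a b c d : ℝ≥0∞} (hc : c ≠ 0) (hc' : c ≠ ⊤) (hd : d ≤ c) :
    a * b ≤ a ^ 2 / d + c * b ^ 2 := by
  rcases le_total a (c * b) with h | h
  · refine le_add_left ?_
    calc a * b ≤ c * b * b := by gcongr
      _ = c * b ^ 2 := by ring
  · refine le_add_right ?_
    calc a * b ≤ a * (a / c) := by
          gcongr
          exact (ENNReal.le_div_iff_mul_le (Or.inl hc) (Or.inl hc')).2 (by rwa [mul_comm])
      _ = a ^ 2 / c := by rw [sq, mul_div_assoc]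
      _ ≤ a ^ 2 / d := by gcongr

theorem enorm_clm_prod_le (L : ℝ × ℝ →L[ℝ] ℝ) : ‖L‖ₑ ≤ ‖L (1, 0)‖ₑ + ‖L (0, 1)‖ₑ := by
  have : ‖L‖ ≤ ‖L (1, 0)‖ + ‖L (0, 1)‖ := by
    refine L.opNorm_le_bound (by positivity) fun v => ?_
    have hv : v = v.1 • (1, 0) + v.2 • ((0, 1) : ℝ × ℝ) := by ext <;> simp
    calc ‖L v‖ = ‖v.1 • L (1, 0) + v.2 • L (0, 1)‖ := by
          conv_lhs => rw [hv, map_add, map_smul, map_smul]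
      _ ≤ ‖v.1‖ * ‖L (1, 0)‖ + ‖v.2‖ * ‖L (0, 1)‖ := by
          refine (norm_add_le _ _).trans ?_
          rw [norm_smul, norm_smul]
      _ ≤ ‖v‖ * ‖L (1, 0)‖ + ‖v‖ * ‖L (0, 1)‖ := by
          gcongr
          exacts [norm_fst_le v, norm_snd_le v]
      _ = _ := by ring
  simp only [← ofReal_norm]
  rw [← ENNReal.ofReal_add (norm_nonneg _) (norm_nonneg _)]
  exact ENNReal.ofReal_le_ofReal this

/-- The critical Sobolev inequality `∫ φ⁴ ≤ C (∫ y |∂ₓφ|² + ∫ x |∂_yφ|²)²`: the planar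
Gagliardo–Nirenberg inequality applied to `φ²` leaves `∫ |φ| |∇φ|`, which is split by
`|φ| |∂ₓφ| ≤ φ² / y + y |∂ₓφ|²`. -/
theorem exists_lintegral_pow_four_le :
    ∃ C : ℝ≥0∞, C ≠ ⊤ ∧ ∀ φ : ℝ × ℝ → ℝ, ContDiff ℝ 1 φ → HasCompactSupport φ →
      tsupport φ ⊆ Ω → ∫⁻ z, ‖φ z‖ₑ ^ 4 ∂μΩ ≤ C * critEnergy φ ^ 2 := by
  refine ⟨lintegralPowLePowLIntegralFDerivConst (volume : Measure (ℝ × ℝ)) 2 * 6 ^ 2, by finiteness,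
    fun φ hφ hc hs => ?_⟩
  have h0 : ∀ z ∉ (Ω : Set (ℝ × ℝ)), φ z = 0 :=
    fun z hz => image_eq_zero_of_notMem_tsupport fun h => hz (hs h)
  have hp : Real.HolderConjugate (Module.finrank ℝ (ℝ × ℝ)) 2 := by
    rw [Module.finrank_prod, Module.finrank_self]
    exact Real.holderConjugate_iff.2 ⟨by norm_num, by norm_num⟩
  have hGN := lintegral_pow_le_pow_lintegral_fderiv (volume : Measure (ℝ × ℝ)) (hφ.pow 2)
    (hc.comp_left (g := fun t : ℝ => t ^ 2) (by norm_num)) hp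
  have hd (z : ℝ × ℝ) : ‖fderiv ℝ (fun z => φ z ^ 2) z‖ₑ ≤
      2 * (‖φ z‖ₑ * ‖fderiv ℝ φ z (1, 0)‖ₑ + ‖φ z‖ₑ * ‖fderiv ℝ φ z (0, 1)‖ₑ) := by
    rw [fderiv_fun_pow 2 (hφ.differentiable (by simp) z), ← mul_add]
    simp only [Nat.add_one_sub_one, pow_one, nsmul_eq_mul, enorm_smul]
    rw [enorm_mul, mul_assoc]
    gcongr
    · simp [Real.enorm_eq_ofReal]
    · exact enorm_clm_prod_le _
  have hgrad : ∫⁻ z, ‖fderiv ℝ (fun z => φ z ^ 2) z‖ₑ ≤ 6 * critEnergy φ := by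
    -- Off `Ω` the gradient of `φ²` vanishes, so that only the integral over `Ω` remains.
    have hind : (fun z => ‖fderiv ℝ (fun z => φ z ^ 2) z‖ₑ) =
        (Ω : Set (ℝ × ℝ)).indicator fun z => ‖fderiv ℝ (fun z => φ z ^ 2) z‖ₑ := by
      refine (indicator_eq_self.2 fun z hz => ?_).symm
      by_contra hzΩ
      have := hd z
      rw [h0 z hzΩ] at this
      exact hz (by simpa using this)
    rw [hind, lintegral_indicator Ω.isOpen.measurableSet]
    refine (lintegral_mono hd).trans ?_
    have hm : Measurable fun z => ‖φ z‖ₑ := hφ.continuous.measurable.enorm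
    have hmin : Measurable fun z : ℝ × ℝ => ‖φ z‖ₑ ^ 2 / ENNReal.ofReal (min z.1 z.2) := by fun_prop
    have hmx : Measurable fun z : ℝ × ℝ =>
        ENNReal.ofReal z.2 * ‖fderiv ℝ φ z (1, 0)‖ₑ ^ 2 :=
      (ENNReal.measurable_ofReal.comp measurable_snd).mul
        ((measurable_enorm_fderiv hφ (1, 0)).pow_const 2)
    have hpt : ∀ᵐ z ∂μΩ,
        2 * (‖φ z‖ₑ * ‖fderiv ℝ φ z (1, 0)‖ₑ + ‖φ z‖ₑ * ‖fderiv ℝ φ z (0, 1)‖ₑ) ≤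
        2 * (2 * (‖φ z‖ₑ ^ 2 / ENNReal.ofReal (min z.1 z.2)) +
          (ENNReal.ofReal z.2 * ‖fderiv ℝ φ z (1, 0)‖ₑ ^ 2 +
          ENNReal.ofReal z.1 * ‖fderiv ℝ φ z (0, 1)‖ₑ ^ 2)) := by
      filter_upwards [self_mem_ae_restrict Ω.isOpen.measurableSet] with ⟨x, y⟩ hz
      obtain ⟨hx, hy⟩ : x ∈ Ioo (0 : ℝ) 1 ∧ y ∈ Ioo (0 : ℝ) 1 := hz
      rw [two_mul (‖φ (x, y)‖ₑ ^ 2 / _), add_add_add_comm]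
      gcongr
      · exact mul_le_sq_div_add_mul_sq (ENNReal.ofReal_pos.2 hy.1).ne' ENNReal.ofReal_ne_top
          (ENNReal.ofReal_le_ofReal (min_le_right _ _))
      · exact mul_le_sq_div_add_mul_sq (ENNReal.ofReal_pos.2 hx.1).ne' ENNReal.ofReal_ne_top
          (ENNReal.ofReal_le_ofReal (min_le_left _ _))
    refine (lintegral_mono_ae hpt).trans ?_
    rw [lintegral_const_mul' _ _ (by simp), lintegral_add_left (hmin.const_mul _),
      lintegral_const_mul' _ _ (by simp), lintegral_add_left hmx]
    calc _ ≤ 2 * (2 * critEnergy φ + critEnergy φ) := by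
          gcongr
          · exact lintegral_sq_div_min_le_critEnergy hφ h0
          · exact le_rfl
      _ = 6 * critEnergy φ := by ring
  calc ∫⁻ z, ‖φ z‖ₑ ^ 4 ∂μΩ ≤ ∫⁻ z, ‖φ z ^ 2‖ₑ ^ (2 : ℝ) := by
        refine (lintegral_mono fun z => ?_).trans (lintegral_mono' Measure.restrict_le_self le_rfl)
        rw [enorm_pow, ENNReal.rpow_two, ← pow_mul]
    _ ≤ _ := hGN
    _ ≤ _ := by
        rw [ENNReal.rpow_two, mul_assoc, ← mul_pow]
        gcongr

/-! ### Approximation by averages over small cells -/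

/-- The mean deviation from the average is at most the average of the mutual deviations. -/
theorem lintegral_enorm_sub_average_le {X : Type*} [MeasurableSpace X] {κ : Measure X}
    [IsFiniteMeasure κ] {f : X → ℝ} (hf : Integrable f κ) :
    ∫⁻ z, ‖f z - (κ.real univ)⁻¹ * ∫ w, f w ∂κ‖ₑ ∂κ ≤
      (κ univ)⁻¹ * ∫⁻ z, ∫⁻ w, ‖f z - f w‖ₑ ∂κ ∂κ := by
  rcases eq_or_ne κ 0 with rfl | h0
  · simp
  have hu : κ univ ≠ 0 := by simpa using h0
  have hr : κ.real univ ≠ 0 := (ENNReal.toReal_pos hu (measure_ne_top _ _)).ne'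
  rw [← lintegral_const_mul' _ _ (ENNReal.inv_ne_top.2 hu)]
  refine lintegral_mono fun z => ?_
  have e : f z - (κ.real univ)⁻¹ * ∫ w, f w ∂κ = (κ.real univ)⁻¹ * ∫ w, (f z - f w) ∂κ := by
    rw [integral_sub (integrable_const _) hf, integral_const, smul_eq_mul, mul_sub,
      inv_mul_cancel_left₀ hr]
  rw [e, enorm_mul]
  gcongr
  · rw [Real.enorm_eq_ofReal (by positivity), ENNReal.ofReal_inv_of_pos (by positivity),
      ofReal_measureReal]
  · exact enorm_integral_le_lintegral_enorm _

theorem enorm_sub_le_setLIntegral_deriv {ψ : ℝ → ℝ} (hψ : ContDiff ℝ 1 ψ) {I : Set ℝ}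
    (hI : I.OrdConnected) {s t : ℝ} (hs : s ∈ I) (ht : t ∈ I) :
    ‖ψ s - ψ t‖ₑ ≤ ∫⁻ r in I, ‖deriv ψ r‖ₑ := by
  wlog h : t ≤ s generalizing s t
  · rw [← enorm_neg, neg_sub]
    exact this ht hs (le_of_not_ge h)
  · exact (enorm_sub_le_lintegral_deriv_of_contDiffOn_Icc hψ.contDiffOn h).trans
      (lintegral_mono_set (hI.out ht hs))

theorem integrableOn_of_subset_Ω {f : ℝ × ℝ → ℝ} (hf : Integrable f μΩ) {Q : Set (ℝ × ℝ)}
    (hQ : Q ⊆ Ω) : IntegrableOn f Q := IntegrableOn.mono_set hf hQ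

/-- The `L¹` Poincaré inequality on a rectangle. -/
theorem lintegral_enorm_sub_average_prod_le {φ : ℝ × ℝ → ℝ} (hφ : ContDiff ℝ 1 φ) {I J : Set ℝ}
    (hI : I.OrdConnected) (hJ : J.OrdConnected) (hφi : IntegrableOn φ (I ×ˢ J))
    {h : ℝ≥0∞} (hIh : volume I ≤ h) (hJh : volume J ≤ h) (hh : h ≠ ⊤) :
    ∫⁻ z in I ×ˢ J, ‖φ z - (volume.real (I ×ˢ J))⁻¹ * ∫ w in I ×ˢ J, φ w‖ₑ ≤
      h * ∫⁻ z in I ×ˢ J, (‖fderiv ℝ φ z (1, 0)‖ₑ + ‖fderiv ℝ φ z (0, 1)‖ₑ) := by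
  have hIm := hI.measurableSet
  have hJm := hJ.measurableSet
  set κ : Measure (ℝ × ℝ) := volume.restrict (I ×ˢ J) with hκ
  have hκp : κ = (volume.restrict I).prod (volume.restrict J) := by
    rw [hκ, Measure.prod_restrict, ← Measure.volume_eq_prod]
  have : IsFiniteMeasure (volume.restrict I) := ⟨by simpa using hIh.trans_lt hh.lt_top⟩
  have : IsFiniteMeasure (volume.restrict J) := ⟨by simpa using hJh.trans_lt hh.lt_top⟩
  have : IsFiniteMeasure κ := by rw [hκp]; infer_instance
  have hm1 := measurable_enorm_fderiv hφ (1, 0)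
  have hm2 := measurable_enorm_fderiv hφ (0, 1)
  set F : ℝ → ℝ≥0∞ := fun y => ∫⁻ x in I, ‖fderiv ℝ φ (x, y) (1, 0)‖ₑ with hF
  set G : ℝ → ℝ≥0∞ := fun x => ∫⁻ y in J, ‖fderiv ℝ φ (x, y) (0, 1)‖ₑ with hG
  have hmF : Measurable F := hm1.lintegral_prod_left'
  have hmG : Measurable G := hm2.lintegral_prod_right'
  have hmF' : Measurable fun z : ℝ × ℝ => F z.2 := hmF.comp measurable_snd
  have hmG' : Measurable fun z : ℝ × ℝ => G z.1 := hmG.comp measurable_fst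
  have hcell : ∀ᵐ z ∂κ, z ∈ I ×ˢ J := ae_restrict_mem (hIm.prod hJm)
  -- Two points of the rectangle are joined by a horizontal and a vertical segment through
  -- `(x', y)`.
  have hpt : ∫⁻ z, ∫⁻ w, ‖φ z - φ w‖ₑ ∂κ ∂κ ≤ ∫⁻ z, ∫⁻ w, (F z.2 + G w.1) ∂κ ∂κ := by
    refine lintegral_mono_ae ?_
    filter_upwards [hcell] with ⟨x, y⟩ hz
    refine lintegral_mono_ae ?_
    filter_upwards [hcell] with ⟨x', y'⟩ hw
    have h1 := enorm_sub_le_setLIntegral_deriv (ψ := fun t => φ (t, y)) (hφ.comp (by fun_prop))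
      hI hz.1 hw.1
    have h2 := enorm_sub_le_setLIntegral_deriv (ψ := fun t => φ (x', t)) (hφ.comp (by fun_prop))
      hJ hz.2 hw.2
    simp only [deriv_slice_fst hφ] at h1
    simp only [deriv_slice_snd hφ] at h2
    calc ‖φ (x, y) - φ (x', y')‖ₑ
        = ‖(φ (x, y) - φ (x', y)) + (φ (x', y) - φ (x', y'))‖ₑ := by rw [sub_add_sub_cancel]
      _ ≤ _ := (enorm_add_le _ _).trans (add_le_add h1 h2)
  have hFκ : ∫⁻ z, F z.2 ∂κ ≤ h * ∫⁻ z, ‖fderiv ℝ φ z (1, 0)‖ₑ ∂κ := by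
    rw [hκp, lintegral_prod_symm' _ hm1, lintegral_prod_symm' _ hmF']
    simp only [lintegral_const, Measure.restrict_apply_univ]
    rw [lintegral_mul_const _ hmF, mul_comm]
    gcongr
  have hGκ : ∫⁻ z, G z.1 ∂κ ≤ h * ∫⁻ z, ‖fderiv ℝ φ z (0, 1)‖ₑ ∂κ := by
    rw [hκp, lintegral_prod _ hm2.aemeasurable,
      lintegral_prod _ hmG'.aemeasurable]
    simp only [lintegral_const, Measure.restrict_apply_univ]
    rw [lintegral_mul_const _ hmG, mul_comm]
    gcongr
  have havg := lintegral_enorm_sub_average_le (κ := κ) hφi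
  have hr : κ.real univ = volume.real (I ×ˢ J) := by simp [hκ, measureReal_def]
  rw [hr] at havg
  refine havg.trans ?_
  calc (κ univ)⁻¹ * ∫⁻ z, ∫⁻ w, ‖φ z - φ w‖ₑ ∂κ ∂κ
      ≤ (κ univ)⁻¹ * ∫⁻ z, ∫⁻ w, (F z.2 + G w.1) ∂κ ∂κ := by gcongr
    _ = (κ univ)⁻¹ * (κ univ * (∫⁻ z, F z.2 ∂κ + ∫⁻ w, G w.1 ∂κ)) := by
        simp only [lintegral_add_left measurable_const, lintegral_const]
        rw [lintegral_add_right _ measurable_const, lintegral_mul_const _ hmF',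
          lintegral_const]
        ring
    _ ≤ ∫⁻ z, F z.2 ∂κ + ∫⁻ w, G w.1 ∂κ := by
        rw [← mul_assoc]
        exact mul_le_of_le_one_left' (ENNReal.inv_mul_le_one _)
    _ ≤ _ := by
        rw [lintegral_add_left hm1, mul_add]
        exact add_le_add hFκ hGκ

/-- The `i`-th of the `n` intervals of length `1 / n` into which the open unit interval is divided.
The intersection with `(0, 1)` only removes the point `0` from the first of them. -/
def slab (n : ℕ) (i : Fin n) : Set ℝ := Ioo 0 1 ∩ Ico (i / n : ℝ) ((i + 1) / n)

theorem ordConnected_slab (n : ℕ) (i : Fin n) : (slab n i).OrdConnected :=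
  ordConnected_Ioo.inter ordConnected_Ico

theorem volume_slab_le (n : ℕ) (i : Fin n) : volume (slab n i) ≤ ENNReal.ofReal (1 / n) := by
  refine (measure_mono inter_subset_right).trans_eq ?_
  rw [Real.volume_Ico]
  congr 1
  ring

theorem eq_of_mem_slab {n : ℕ} {i j : Fin n} {t : ℝ} (hi : t ∈ slab n i) (hj : t ∈ slab n j) :
    i = j := by
  have hn : (0 : ℝ) < n := by exact_mod_cast i.pos
  have h1 := hi.2.1.trans_lt hj.2.2
  have h2 := hj.2.1.trans_lt hi.2.2
  rw [div_lt_div_iff_of_pos_right hn] at h1 h2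
  norm_cast at h1 h2
  exact Fin.ext (by omega)

theorem exists_mem_slab {n : ℕ} (hn : 0 < n) {t : ℝ} (ht : t ∈ Ioo (0 : ℝ) 1) :
    ∃ i, t ∈ slab n i := by
  have hn' : (0 : ℝ) < n := by exact_mod_cast hn
  have h0 : 0 ≤ t * n := by have := ht.1; positivity
  have hlt : ⌊t * n⌋₊ < n := (Nat.floor_lt h0).2 (by nlinarith [ht.2])
  refine ⟨⟨⌊t * n⌋₊, hlt⟩, ht, ?_, ?_⟩
  · rw [div_le_iff₀ hn']
    exact Nat.floor_le h0
  · rw [lt_div_iff₀ hn']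
    exact Nat.lt_floor_add_one _

/-- The square cells of side `1 / n` into which the unit square is divided. -/
def cell (n : ℕ) (q : Fin n × Fin n) : Set (ℝ × ℝ) := slab n q.1 ×ˢ slab n q.2

theorem measurableSet_cell (n : ℕ) (q : Fin n × Fin n) : MeasurableSet (cell n q) :=
  (ordConnected_slab n _).measurableSet.prod (ordConnected_slab n _).measurableSet

theorem cell_subset_Ω (n : ℕ) (q : Fin n × Fin n) : cell n q ⊆ Ω :=
  fun _ hz => ⟨hz.1.1, hz.2.1⟩

theorem μΩ_restrict_cell (n : ℕ) (q : Fin n × Fin n) :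
    μΩ.restrict (cell n q) = volume.restrict (cell n q) :=
  Measure.restrict_restrict_of_subset (cell_subset_Ω n q)

theorem pairwise_disjoint_cell (n : ℕ) : Pairwise (Function.onFun Disjoint (cell n)) := by
  intro q r hqr
  refine Set.disjoint_left.2 fun z hq hr => hqr ?_
  exact Prod.ext (eq_of_mem_slab hq.1 hr.1) (eq_of_mem_slab hq.2 hr.2)

theorem iUnion_cell {n : ℕ} (hn : 0 < n) : ⋃ q, cell n q = (Ω : Set (ℝ × ℝ)) := by
  refine subset_antisymm (iUnion_subset (cell_subset_Ω n)) fun z hz => ?_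
  obtain ⟨i, hi⟩ := exists_mem_slab hn hz.1
  obtain ⟨j, hj⟩ := exists_mem_slab hn hz.2
  exact mem_iUnion.2 ⟨(i, j), hi, hj⟩

/-- The piecewise constant function taking on every cell the average of `f` over that cell, and the
value `0` outside the cells. -/
noncomputable def cellAverage (n : ℕ) (f : ℝ × ℝ → ℝ) (z : ℝ × ℝ) : ℝ :=
  ∑ q, (cell n q).indicator (fun _ => (μΩ.real (cell n q))⁻¹ * ∫ w in cell n q, f w ∂μΩ) z

theorem cellAverage_of_mem {n : ℕ} {q : Fin n × Fin n} {z : ℝ × ℝ} (hz : z ∈ cell n q)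
    (f : ℝ × ℝ → ℝ) :
    cellAverage n f z = (μΩ.real (cell n q))⁻¹ * ∫ w in cell n q, f w ∂μΩ := by
  rw [cellAverage, Finset.sum_eq_single q, indicator_of_mem hz]
  · intro r _ hr
    exact indicator_of_notMem (fun h => Set.disjoint_left.1 (pairwise_disjoint_cell n hr) h hz) _
  · simp

theorem lintegral_enorm_sub_cellAverage_le {φ : ℝ × ℝ → ℝ} (hφ : ContDiff ℝ 1 φ)
    (hφi : Integrable φ μΩ) {n : ℕ} (hn : 0 < n) :
    ∫⁻ z, ‖φ z - cellAverage n φ z‖ₑ ∂μΩ ≤ ENNReal.ofReal (1 / n) *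
      ∫⁻ z, (‖fderiv ℝ φ z (1, 0)‖ₑ + ‖fderiv ℝ φ z (0, 1)‖ₑ) ∂μΩ := by
  change ∫⁻ z in (Ω : Set (ℝ × ℝ)), _ ≤ _ * ∫⁻ z in (Ω : Set (ℝ × ℝ)), _
  rw [← iUnion_cell hn, lintegral_iUnion (measurableSet_cell n) (pairwise_disjoint_cell n),
    lintegral_iUnion (measurableSet_cell n) (pairwise_disjoint_cell n), ← ENNReal.tsum_mul_left]
  refine ENNReal.tsum_le_tsum fun q => ?_
  refine le_trans (le_of_eq ?_) (lintegral_enorm_sub_average_prod_le hφ (ordConnected_slab n q.1)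
    (ordConnected_slab n q.2) (integrableOn_of_subset_Ω hφi (cell_subset_Ω n q))
    (volume_slab_le n q.1) (volume_slab_le n q.2) ENNReal.ofReal_ne_top)
  refine setLIntegral_congr_fun (measurableSet_cell n q) fun z hz => ?_
  have hreal : μΩ.real (cell n q) = volume.real (cell n q) := by
    rw [measureReal_def, measureReal_def, Measure.restrict_apply (measurableSet_cell n q),
      inter_eq_left.2 (cell_subset_Ω n q)]
  rw [cellAverage_of_mem hz, μΩ_restrict_cell, hreal]
  rfl

/-- The average over a cell, as a continuous linear functional on `L¹(Ω)`. -/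
noncomputable def cellAverageFunctional (n : ℕ) (q : Fin n × Fin n) : Lp ℝ 1 μΩ →L[ℝ] ℝ :=
  (μΩ.real (cell n q))⁻¹ • (L1.integralCLM' ℝ).comp
    (LpToLpRestrictCLM (ℝ × ℝ) ℝ ℝ μΩ 1 (cell n q))

theorem cellAverageFunctional_apply (n : ℕ) (q : Fin n × Fin n) (f : Lp ℝ 1 μΩ) :
    cellAverageFunctional n q f = (μΩ.real (cell n q))⁻¹ * ∫ w in cell n q, f w ∂μΩ := by
  rw [cellAverageFunctional, smul_apply, ContinuousLinearMap.comp_apply, smul_eq_mul,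
    ← L1.integral_eq', L1.integral_eq_integral,
    integral_congr_ae (LpToLpRestrictCLM_coeFn ℝ (cell n q) f)]

/-- The indicator function of a cell, as an element of `L¹(Ω)`. -/
noncomputable def cellIndicator (n : ℕ) (q : Fin n × Fin n) : Lp ℝ 1 μΩ :=
  indicatorConstLp 1 (measurableSet_cell n q) (measure_ne_top μΩ _) 1

/-- The operator `f ↦ cellAverage n f` on `L¹(Ω)`. -/
noncomputable def cellAverageCLM (n : ℕ) : Lp ℝ 1 μΩ →L[ℝ] Lp ℝ 1 μΩ :=
  ∑ q, (cellAverageFunctional n q).smulRight (cellIndicator n q)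

theorem coeFn_sum_Lp {X ι : Type*} [MeasurableSpace X] {μ : Measure X} {p : ℝ≥0∞} (s : Finset ι)
    (f : ι → Lp ℝ p μ) : ⇑(∑ i ∈ s, f i) =ᵐ[μ] fun x => ∑ i ∈ s, f i x := by
  classical
  induction s using Finset.induction_on with
  | empty =>
    simp only [Finset.sum_empty]
    exact Lp.coeFn_zero ℝ p μ
  | insert i s hi ih =>
    rw [Finset.sum_insert hi]
    filter_upwards [Lp.coeFn_add (f i) (∑ j ∈ s, f j), ih] with x h1 h2
    rw [h1, Pi.add_apply, h2, Finset.sum_insert hi]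

theorem coeFn_cellAverageCLM (n : ℕ) (f : Lp ℝ 1 μΩ) :
    cellAverageCLM n f =ᵐ[μΩ] cellAverage n f := by
  have hq : ∀ᵐ z ∂μΩ, ∀ q, (cellAverageFunctional n q).smulRight (cellIndicator n q) f z =
      (cell n q).indicator (fun _ => (μΩ.real (cell n q))⁻¹ * ∫ w in cell n q, f w ∂μΩ) z := by
    refine ae_all_iff.2 fun q => ?_
    rw [ContinuousLinearMap.smulRight_apply, cellAverageFunctional_apply]
    filter_upwards [Lp.coeFn_smul ((μΩ.real (cell n q))⁻¹ * ∫ w in cell n q, f w ∂μΩ)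
      (cellIndicator n q), indicatorConstLp_coeFn (p := 1) (hs := measurableSet_cell n q)
        (hμs := measure_ne_top μΩ _) (c := (1 : ℝ))] with z h1 h2
    rw [h1, Pi.smul_apply, cellIndicator, h2, smul_eq_mul]
    by_cases hz : z ∈ cell n q <;> simp [hz]
  rw [cellAverageCLM, sum_apply]
  filter_upwards [coeFn_sum_Lp (Finset.univ : Finset (Fin n × Fin n)) _, hq] with z h1 h2
  rw [h1]
  exact Finset.sum_congr rfl fun q _ => h2 q

theorem isCompactOperator_cellAverageCLM (n : ℕ) : IsCompactOperator (cellAverageCLM n) := by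
  have : cellAverageCLM n ∈ compactOperator (RingHom.id ℝ) (Lp ℝ 1 μΩ) (Lp ℝ 1 μΩ) := by
    refine Submodule.sum_mem _ fun q _ => ?_
    exact (isCompactOperator_of_locallyCompactSpace_dom (cellAverageFunctional n q)).clm_comp
      (ContinuousLinearMap.toSpanSingleton ℝ (cellIndicator n q))
  exact this

/-! ### Test functions in the weighted space -/

/-- The seminormed structure of `𝓗¹(Ω)` as a subspace of `L² ⊕ L² ⊕ L²`, fixed so that instance
search for the nested subspace `𝓗₀¹(Ω)` finds one path only. -/
noncomputable instance H1.instSeminormedAddCommGroup (α₁ α₂ : ℝ) :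
    SeminormedAddCommGroup (H1 α₁ α₂) := Submodule.seminormedAddCommGroup _

noncomputable instance H1.instNormedSpace (α₁ α₂ : ℝ) : NormedSpace ℝ (H1 α₁ α₂) :=
  Submodule.normedSpace _

noncomputable instance H01.instSeminormedAddCommGroup (α₁ α₂ : ℝ) :
    SeminormedAddCommGroup (H01 α₁ α₂) := Submodule.seminormedAddCommGroup _

noncomputable instance H01.instNormedSpace (α₁ α₂ : ℝ) : NormedSpace ℝ (H01 α₁ α₂) :=
  Submodule.normedSpace _

/-- The part `∫ |y^α₁ ∂ₓφ|² + ∫ |x^α₂ ∂_yφ|²` of the squared norm of `𝓗¹(Ω)`. -/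
noncomputable def weightedEnergy (α₁ α₂ : ℝ) (φ : ℝ × ℝ → ℝ) : ℝ≥0∞ :=
  (∫⁻ z, ‖z.2 ^ α₁ * fderiv ℝ φ z (1, 0)‖ₑ ^ 2 ∂μΩ) +
    ∫⁻ z, ‖z.1 ^ α₂ * fderiv ℝ φ z (0, 1)‖ₑ ^ 2 ∂μΩ

theorem ofReal_mul_enorm_sq_le {α t : ℝ} (hα : α ≤ 1 / 2) (ht : t ∈ Ioo (0 : ℝ) 1) (c : ℝ) :
    ENNReal.ofReal t * ‖c‖ₑ ^ 2 ≤ ‖t ^ α * c‖ₑ ^ 2 := by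
  rw [enorm_mul, mul_pow]
  gcongr
  rw [Real.enorm_eq_ofReal (Real.rpow_nonneg ht.1.le _),
    ← ENNReal.ofReal_pow (Real.rpow_nonneg ht.1.le _), ← Real.rpow_mul_natCast ht.1.le]
  refine ENNReal.ofReal_le_ofReal ?_
  calc t = t ^ (1 : ℝ) := (Real.rpow_one t).symm
    _ ≤ t ^ (α * (2 : ℕ)) := Real.rpow_le_rpow_of_exponent_ge ht.1 ht.2.le (by
        push_cast; linarith)

theorem critEnergy_le_weightedEnergy {α₁ α₂ : ℝ} (h₁ : α₁ ≤ 1 / 2) (h₂ : α₂ ≤ 1 / 2)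
    (φ : ℝ × ℝ → ℝ) : critEnergy φ ≤ weightedEnergy α₁ α₂ φ := by
  refine add_le_add (lintegral_mono_ae ?_) (lintegral_mono_ae ?_)
  · filter_upwards [self_mem_ae_restrict Ω.isOpen.measurableSet] with z hz
    exact ofReal_mul_enorm_sq_le h₁ hz.2 _
  · filter_upwards [self_mem_ae_restrict Ω.isOpen.measurableSet] with z hz
    exact ofReal_mul_enorm_sq_le h₂ hz.1 _

instance isProbabilityMeasure_unitMeasure : IsProbabilityMeasure unitMeasure :=
  ⟨by simp [unitMeasure]⟩

instance isProbabilityMeasure_μΩ : IsProbabilityMeasure μΩ := by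
  rw [μΩ_eq_prod]
  infer_instance

/-- The square of the dual weight `t^(-α)` is integrable precisely because `α < 1/2`. -/
theorem lintegral_dual_weight_lt_top {α : ℝ} (hα : α < 1 / 2) :
    ∫⁻ t, ‖t ^ (-α)‖ₑ ^ 2 ∂unitMeasure < ⊤ := by
  have h : IntegrableOn (fun t : ℝ => t ^ (-α * (2 : ℕ))) (Ioo 0 1) :=
    (intervalIntegral.integrableOn_Ioo_rpow_iff one_pos).2 (by push_cast; linarith)
  refine lt_of_eq_of_lt (lintegral_congr_ae ?_) h.hasFiniteIntegral
  filter_upwards [self_mem_ae_restrict measurableSet_Ioo] with t ht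
  rw [← enorm_pow, Real.rpow_mul_natCast ht.1.le]

/-- Cauchy–Schwarz for the splitting `g = w ^ (-α) * (w ^ α * g)`. -/
theorem sq_lintegral_enorm_le_of_weight {α : ℝ} {w : ℝ × ℝ → ℝ} (hw : Measurable w)
    (hpos : ∀ z ∈ Ω, 0 < w z) {g : ℝ × ℝ → ℝ} (hg : Measurable g) :
    (∫⁻ z, ‖g z‖ₑ ∂μΩ) ^ 2 ≤
      (∫⁻ z, ‖w z ^ (-α)‖ₑ ^ 2 ∂μΩ) * ∫⁻ z, ‖w z ^ α * g z‖ₑ ^ 2 ∂μΩ := by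
  refine le_of_eq_of_le ?_ (sq_lintegral_mul_le (hw.pow_const _).enorm.aemeasurable
    ((hw.pow_const _).mul hg).enorm.aemeasurable)
  congr 1
  refine lintegral_congr_ae ?_
  filter_upwards [self_mem_ae_restrict Ω.isOpen.measurableSet] with z hz
  rw [← enorm_mul, ← mul_assoc, ← Real.rpow_add (hpos z hz), neg_add_cancel, Real.rpow_zero,
    one_mul]

theorem le_rpow_half_mul_of_sq_le {a W N : ℝ≥0∞} (h : a ^ 2 ≤ W * N ^ 2) :
    a ≤ W ^ (1 / 2 : ℝ) * N := by
  refine (ENNReal.pow_le_pow_left_iff two_ne_zero).1 ?_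
  rwa [mul_pow, ← ENNReal.rpow_natCast (W ^ (1 / 2 : ℝ)), ← ENNReal.rpow_mul, Nat.cast_ofNat,
    one_div_mul_cancel two_ne_zero, ENNReal.rpow_one]

/-- For exponents below `1/2` the gradient of a test function is controlled in `L¹(Ω)`. -/
theorem exists_lintegral_gradient_le {α₁ α₂ : ℝ} (h₁ : α₁ < 1 / 2) (h₂ : α₂ < 1 / 2) :
    ∃ C : ℝ≥0∞, C ≠ ⊤ ∧ ∀ φ : ℝ × ℝ → ℝ, ContDiff ℝ 1 φ → ∀ N : ℝ≥0∞,
      weightedEnergy α₁ α₂ φ ≤ N ^ 2 →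
      ∫⁻ z, (‖fderiv ℝ φ z (1, 0)‖ₑ + ‖fderiv ℝ φ z (0, 1)‖ₑ) ∂μΩ ≤ C * N := by
  have hW₁ : ∫⁻ z, ‖z.2 ^ (-α₁)‖ₑ ^ 2 ∂μΩ ≠ ⊤ := by
    rw [μΩ_eq_prod, (measurePreserving_snd (μ := unitMeasure) (ν := unitMeasure)).lintegral_comp
      (f := fun t => ‖t ^ (-α₁)‖ₑ ^ 2) (by fun_prop)]
    exact (lintegral_dual_weight_lt_top h₁).ne
  have hW₂ : ∫⁻ z, ‖z.1 ^ (-α₂)‖ₑ ^ 2 ∂μΩ ≠ ⊤ := by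
    rw [μΩ_eq_prod, (measurePreserving_fst (μ := unitMeasure) (ν := unitMeasure)).lintegral_comp
      (f := fun t => ‖t ^ (-α₂)‖ₑ ^ 2) (by fun_prop)]
    exact (lintegral_dual_weight_lt_top h₂).ne
  refine ⟨_, ENNReal.add_ne_top.2
    ⟨ENNReal.rpow_ne_top_of_nonneg (y := 1 / 2) (by norm_num) hW₁,
      ENNReal.rpow_ne_top_of_nonneg (y := 1 / 2) (by norm_num) hW₂⟩, fun φ hφ N hN => ?_⟩
  have hm (e : ℝ × ℝ) : Measurable fun z => fderiv ℝ φ z e :=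
    ((hφ.continuous_fderiv (by simp)).clm_apply continuous_const).measurable
  rw [lintegral_add_left (hm _).enorm, add_mul]
  refine add_le_add (le_rpow_half_mul_of_sq_le ?_) (le_rpow_half_mul_of_sq_le ?_)
  · refine (sq_lintegral_enorm_le_of_weight (α := α₁) measurable_snd (fun z hz => hz.2.1)
      (hm _)).trans ?_
    gcongr
    exact (le_add_right le_rfl).trans hN
  · refine (sq_lintegral_enorm_le_of_weight (α := α₂) measurable_fst (fun z hz => hz.1.1)
      (hm _)).trans ?_
    gcongr
    exact (le_add_left le_rfl).trans hN

theorem CcInfty.contDiff_one (φ : CcInfty) : ContDiff ℝ 1 φ :=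
  φ.contDiff.of_le (by exact_mod_cast le_top)

theorem isWeakDeriv_test (φ : CcInfty) (e : ℝ × ℝ) :
    IsWeakDeriv e φ (fun z => fderiv ℝ φ z e) := by
  have l1 : LocallyIntegrable φ (volume : Measure (ℝ × ℝ)) := φ.continuous.locallyIntegrable
  have l2 : LocallyIntegrable (fun z => fderiv ℝ φ z e) (volume : Measure (ℝ × ℝ)) :=
    (continuous_fderiv_test φ e).locallyIntegrable
  refine ⟨l1.locallyIntegrableOn _, l2.locallyIntegrableOn _, fun ψ => ?_⟩
  have hφ0 : ∀ z ∉ (Ω : Set (ℝ × ℝ)), φ z = 0 := fun z hz =>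
    image_eq_zero_of_notMem_tsupport fun h => hz (φ.tsupport_subset h)
  have hψ0 : ∀ z ∉ (Ω : Set (ℝ × ℝ)), ψ z = 0 := fun z hz =>
    image_eq_zero_of_notMem_tsupport fun h => hz (ψ.tsupport_subset h)
  rw [setIntegral_eq_integral_of_forall_compl_eq_zero fun z hz => by rw [hφ0 z hz, zero_mul],
    setIntegral_eq_integral_of_forall_compl_eq_zero fun z hz => by rw [hψ0 z hz, mul_zero]]
  refine integral_mul_fderiv_eq_neg_fderiv_mul_of_integrable ?_ ?_ ?_
    (fun z _ => (CcInfty.contDiff_one φ).differentiable (by simp) z)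
    (fun z _ => (CcInfty.contDiff_one ψ).differentiable (by simp) z)
  · exact ((continuous_fderiv_test φ e).mul ψ.continuous).integrable_of_hasCompactSupport
      ψ.hasCompactSupport.mul_left
  · exact (φ.continuous.mul (continuous_fderiv_test ψ e)).integrable_of_hasCompactSupport
      φ.hasCompactSupport.mul_right
  · exact (φ.continuous.mul ψ.continuous).integrable_of_hasCompactSupport
      φ.hasCompactSupport.mul_right

theorem lintegral_sq_enorm_L2 (f : L2) : ∫⁻ z, ‖f z‖ₑ ^ 2 ∂μΩ = ‖f‖ₑ ^ 2 := by
  rw [Lp.enorm_def]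
  have := eLpNorm_nnreal_pow_eq_lintegral (f := (f : ℝ × ℝ → ℝ)) (μ := μΩ) (p := 2) two_ne_zero
  simpa using this.symm

/-- Uniqueness of weak derivatives identifies the stored components of a test function with its
weighted classical derivatives. -/
theorem weightedEnergy_le_enorm_sq {α₁ α₂ : ℝ} (U : H1 α₁ α₂) {φ : CcInfty}
    (h : H1.toL2 U =ᵐ[μΩ] φ) : weightedEnergy α₁ α₂ φ ≤ ‖U‖ₑ ^ 2 := by
  obtain ⟨g₁, g₂, hg₁, hg₂, e₁, e₂⟩ := U.2
  have hw (e : ℝ × ℝ) := (isWeakDeriv_test φ e).congr (locallyIntegrableOn_L2 (H1.toL2 U)) h.symm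
  have i₁ : ∫⁻ z, ‖z.2 ^ α₁ * fderiv ℝ φ z (1, 0)‖ₑ ^ 2 ∂μΩ =
      ‖(U : PiLp 2 (fun _ : Fin 3 => L2)) 1‖ₑ ^ 2 := by
    rw [← lintegral_sq_enorm_L2]
    refine lintegral_congr_ae ?_
    filter_upwards [e₁, hg₁.ae_eq (hw (1, 0))] with z h1 h2
    rw [h1, h2]
  have i₂ : ∫⁻ z, ‖z.1 ^ α₂ * fderiv ℝ φ z (0, 1)‖ₑ ^ 2 ∂μΩ =
      ‖(U : PiLp 2 (fun _ : Fin 3 => L2)) 2‖ₑ ^ 2 := by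
    rw [← lintegral_sq_enorm_L2]
    refine lintegral_congr_ae ?_
    filter_upwards [e₂, hg₂.ae_eq (hw (0, 1))] with z h1 h2
    rw [h1, h2]
  rw [weightedEnergy, i₁, i₂]
  have hn := PiLp.norm_sq_eq_of_L2 (fun _ : Fin 3 => L2) (U : PiLp 2 (fun _ : Fin 3 => L2))
  rw [Fin.sum_univ_three] at hn
  simp only [← ofReal_norm, ← ENNReal.ofReal_pow (norm_nonneg _)]
  rw [← ENNReal.ofReal_add (by positivity) (by positivity)]
  refine ENNReal.ofReal_le_ofReal ?_
  have : ‖U‖ = ‖(U : PiLp 2 (fun _ : Fin 3 => L2))‖ := rfl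
  rw [this, hn]
  nlinarith [sq_nonneg ‖(U : PiLp 2 (fun _ : Fin 3 => L2)) 0‖]

/-! ### The embeddings of the closure of the test functions -/

/-- A closed property of elements of `𝓗₀¹(Ω)` need only be verified for test functions. -/
theorem H01.induction_on_test {α₁ α₂ : ℝ} {P : H01 α₁ α₂ → Prop} (hP : IsClosed {U | P U})
    (h : ∀ (U : H01 α₁ α₂) (φ : CcInfty), H01.toL2 U =ᵐ[μΩ] φ → P U) (U : H01 α₁ α₂) : P U := by
  obtain ⟨V, hV, hVU⟩ := mem_closure_iff_seq_limit.1
    (show (U : H1 α₁ α₂) ∈ closure (smoothCompact α₁ α₂ : Set (H1 α₁ α₂)) from U.2)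
  have hlim : Filter.Tendsto (fun n => (⟨V n, subset_closure (hV n)⟩ : H01 α₁ α₂)) Filter.atTop
      (nhds U) := tendsto_subtype_rng.2 hVU
  refine hP.mem_of_tendsto hlim (Filter.Eventually.of_forall fun n => ?_)
  obtain ⟨φ, hφ⟩ := hV n
  exact h _ φ hφ

theorem H01.continuous_toL2 {α₁ α₂ : ℝ} : Continuous (H01.toL2 : H01 α₁ α₂ → L2) :=
  (PiLp.continuous_apply 2 (fun _ : Fin 3 => L2) 0).comp
    (continuous_subtype_val.comp continuous_subtype_val)

/-- Lower semicontinuity of the `L^p` norm along `L²` convergence, by Fatou's lemma. -/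
theorem isClosed_eLpNorm_toL2_le {α₁ α₂ : ℝ} (C p : ℝ≥0∞) (hC : C ≠ ⊤) :
    IsClosed {U : H01 α₁ α₂ | eLpNorm (H01.toL2 U) p μΩ ≤ C * ‖U‖ₑ} := by
  refine IsSeqClosed.isClosed fun V U hV hVU => ?_
  obtain ⟨ns, hns, hae⟩ := (tendstoInMeasure_of_tendsto_Lp
    ((H01.continuous_toL2.tendsto U).comp hVU)).exists_seq_tendsto_ae
  have hlim : Filter.Tendsto (fun k => C * ‖V (ns k)‖ₑ) Filter.atTop (nhds (C * ‖U‖ₑ)) :=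
    ENNReal.Tendsto.const_mul ((continuous_enorm.tendsto U).comp
      (hVU.comp hns.tendsto_atTop)) (Or.inr hC)
  calc eLpNorm (H01.toL2 U) p μΩ
      ≤ Filter.atTop.liminf fun k => eLpNorm (H01.toL2 (V (ns k))) p μΩ :=
        Lp.eLpNorm_lim_le_liminf_eLpNorm (fun k => Lp.aestronglyMeasurable _) _ hae
    _ ≤ Filter.atTop.liminf fun k => C * ‖V (ns k)‖ₑ :=
        Filter.liminf_le_liminf (Filter.Eventually.of_forall fun k => hV (ns k))
    _ = C * ‖U‖ₑ := hlim.liminf_eq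

/-- The critical embedding of `𝓗₀¹(Ω)` into `L⁴(Ω)`. -/
theorem exists_eLpNorm_four_le {α₁ α₂ : ℝ} (h₁ : α₁ ≤ 1 / 2) (h₂ : α₂ ≤ 1 / 2) :
    ∃ C : ℝ≥0∞, C ≠ ⊤ ∧ ∀ U : H01 α₁ α₂, eLpNorm (H01.toL2 U) 4 μΩ ≤ C * ‖U‖ₑ := by
  obtain ⟨C, hC, h⟩ := exists_lintegral_pow_four_le
  have hC' : C ^ (1 / 4 : ℝ) ≠ ⊤ := ENNReal.rpow_ne_top_of_nonneg (by norm_num) hC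
  refine ⟨C ^ (1 / 4 : ℝ), hC', H01.induction_on_test (isClosed_eLpNorm_toL2_le _ _ hC')
    fun U φ hφ => ?_⟩
  have hE : critEnergy φ ≤ ‖U‖ₑ ^ 2 :=
    (critEnergy_le_weightedEnergy h₁ h₂ φ).trans (weightedEnergy_le_enorm_sq (U : H1 α₁ α₂) hφ)
  have hint := h φ φ.contDiff_one φ.hasCompactSupport φ.tsupport_subset
  have h4 : eLpNorm φ 4 μΩ ^ 4 = ∫⁻ z, ‖φ z‖ₑ ^ 4 ∂μΩ := by
    have := eLpNorm_nnreal_pow_eq_lintegral (f := φ) (μ := μΩ) (p := 4) (by norm_num)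
    simpa only [NNReal.coe_ofNat, ENNReal.coe_ofNat, ← Nat.cast_ofNat (R := ℝ),
      ENNReal.rpow_natCast] using this
  rw [eLpNorm_congr_ae hφ]
  refine (ENNReal.pow_le_pow_left_iff four_ne_zero).1 ?_
  rw [h4, mul_pow, ← ENNReal.rpow_natCast (C ^ (1 / 4 : ℝ)), ← ENNReal.rpow_mul, Nat.cast_ofNat,
    one_div_mul_cancel four_ne_zero, ENNReal.rpow_one]
  refine hint.trans ?_
  calc C * critEnergy φ ^ 2 ≤ C * (‖U‖ₑ ^ 2) ^ 2 := by gcongr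
    _ = _ := by rw [← pow_mul]

theorem memLp_of_eLpNorm_four_le {α₁ α₂ : ℝ} {C : ℝ≥0∞} (hC : C ≠ ⊤)
    (h : ∀ U : H01 α₁ α₂, eLpNorm (H01.toL2 U) 4 μΩ ≤ C * ‖U‖ₑ) {p : ℝ≥0∞} (hp : p ≤ 4)
    (U : H01 α₁ α₂) : MemLp (H01.toL2 U) p μΩ :=
  MemLp.mono_exponent ⟨Lp.aestronglyMeasurable _,
    (h U).trans_lt (ENNReal.mul_lt_top hC.lt_top enorm_lt_top)⟩ hp

/-- The inclusion of `𝓗₀¹(Ω)` into `L^p(Ω)` for `1 ≤ p ≤ 4`. -/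
theorem exists_inclusion {α₁ α₂ : ℝ} (h₁ : α₁ ≤ 1 / 2) (h₂ : α₂ ≤ 1 / 2) (p : ℝ≥0∞)
    [Fact (1 ≤ p)] (hp : p ≤ 4) :
    ∃ ι : H01 α₁ α₂ →L[ℝ] Lp ℝ p μΩ, ∀ U, ι U =ᵐ[μΩ] H01.toL2 U := by
  obtain ⟨C, hC, h⟩ := exists_eLpNorm_four_le h₁ h₂
  have hmem := memLp_of_eLpNorm_four_le hC h hp
  let L : H01 α₁ α₂ →ₗ[ℝ] Lp ℝ p μΩ :=
    { toFun := fun U => (hmem U).toLp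
      map_add' := fun U V => by
        rw [← MemLp.toLp_add]
        exact MemLp.toLp_congr _ _ (Lp.coeFn_add _ _)
      map_smul' := fun c U => by
        rw [RingHom.id_apply, ← MemLp.toLp_const_smul]
        exact MemLp.toLp_congr _ _ (Lp.coeFn_smul _ _) }
  refine ⟨L.mkContinuous C.toReal fun U => ?_, fun U => (hmem U).coeFn_toLp⟩
  have hU : eLpNorm (H01.toL2 U) p μΩ ≤ C * ‖U‖ₑ :=
    (eLpNorm_le_eLpNorm_of_exponent_le hp (Lp.aestronglyMeasurable _)).trans (h U)
  change ‖(hmem U).toLp‖ ≤ _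
  rw [Lp.norm_toLp, ← toReal_enorm, ← ENNReal.toReal_mul]
  exact ENNReal.toReal_mono (ENNReal.mul_ne_top hC enorm_ne_top) hU

/-! ### Compactness -/

/-- Averages over cells of side `1 / n` approximate the inclusion into `L¹(Ω)` in operator norm. -/
theorem exists_norm_sub_cellAverageCLM_le {α₁ α₂ : ℝ} (h₁ : α₁ < 1 / 2) (h₂ : α₂ < 1 / 2)
    (ι : H01 α₁ α₂ →L[ℝ] Lp ℝ 1 μΩ) (hι : ∀ U, ι U =ᵐ[μΩ] H01.toL2 U) :
    ∃ C : ℝ, 0 ≤ C ∧ ∀ n : ℕ, 0 < n → ∀ U, ‖ι U - cellAverageCLM n (ι U)‖ ≤ 1 / n * C * ‖U‖ := by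
  obtain ⟨C, hC, h⟩ := exists_lintegral_gradient_le h₁ h₂
  refine ⟨C.toReal, ENNReal.toReal_nonneg, fun n hn => H01.induction_on_test
    (isClosed_le (by fun_prop) (by fun_prop)) fun U φ hφ => ?_⟩
  have hιφ : ι U =ᵐ[μΩ] φ := (hι U).trans hφ
  have hφi : Integrable φ μΩ := (L1.integrable_coeFn (ι U)).congr hιφ
  have hav : cellAverageCLM n (ι U) =ᵐ[μΩ] cellAverage n φ := by
    refine (coeFn_cellAverageCLM n (ι U)).trans (Filter.Eventually.of_forall fun z => ?_)
    unfold cellAverage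
    refine Finset.sum_congr rfl fun q _ => ?_
    rw [integral_congr_ae (ae_restrict_of_ae hιφ)]
  have henorm : ‖ι U - cellAverageCLM n (ι U)‖ₑ ≤ ENNReal.ofReal (1 / n) * (C * ‖U‖ₑ) := by
    rw [Lp.enorm_def, eLpNorm_one_eq_lintegral_enorm]
    calc ∫⁻ z, ‖(ι U - cellAverageCLM n (ι U) : Lp ℝ 1 μΩ) z‖ₑ ∂μΩ
        = ∫⁻ z, ‖φ z - cellAverage n φ z‖ₑ ∂μΩ := by
          refine lintegral_congr_ae ?_
          filter_upwards [Lp.coeFn_sub (ι U) (cellAverageCLM n (ι U)), hιφ, hav] with z a b c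
          rw [a, Pi.sub_apply, b, c]
      _ ≤ _ := lintegral_enorm_sub_cellAverage_le φ.contDiff_one hφi hn
      _ ≤ _ := by
          gcongr
          exact h φ φ.contDiff_one ‖U‖ₑ (weightedEnergy_le_enorm_sq (U : H1 α₁ α₂) hφ)
  rw [← toReal_enorm, ← toReal_enorm (U : H01 α₁ α₂), mul_assoc, ← ENNReal.toReal_mul,
    ← ENNReal.toReal_ofReal (show (0 : ℝ) ≤ 1 / n by positivity), ← ENNReal.toReal_mul]
  exact ENNReal.toReal_mono (by finiteness) henorm

theorem isCompactOperator_of_norm_sub_le {E F : Type*} [SeminormedAddCommGroup E]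
    [NormedSpace ℝ E] [NormedAddCommGroup F] [NormedSpace ℝ F] [CompleteSpace F] {T : E →L[ℝ] F}
    {S : ℕ → E →L[ℝ] F} (hS : ∀ n, IsCompactOperator (S n)) {c : ℕ → ℝ} (hc0 : ∀ n, 0 ≤ c n)
    (hc : Filter.Tendsto c Filter.atTop (nhds 0))
    (h : ∀ᶠ n in Filter.atTop, ∀ x, ‖T x - S n x‖ ≤ c n * ‖x‖) : IsCompactOperator T := by
  refine isCompactOperator_of_tendsto (l := Filter.atTop) (F := S) ?_
    (Filter.Eventually.of_forall hS)
  rw [tendsto_iff_norm_sub_tendsto_zero]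
  refine squeeze_zero' (Filter.Eventually.of_forall fun n => norm_nonneg _) ?_ hc
  filter_upwards [h] with n hn
  rw [norm_sub_rev]
  exact ContinuousLinearMap.opNorm_le_bound _ (hc0 n) hn

theorem isCompactOperator_inclusion_one {α₁ α₂ : ℝ} (h₁ : α₁ < 1 / 2) (h₂ : α₂ < 1 / 2)
    (ι : H01 α₁ α₂ →L[ℝ] Lp ℝ 1 μΩ) (hι : ∀ U, ι U =ᵐ[μΩ] H01.toL2 U) :
    IsCompactOperator ι := by
  obtain ⟨C, hC, h⟩ := exists_norm_sub_cellAverageCLM_le h₁ h₂ ι hι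
  have hlim : Filter.Tendsto (fun n : ℕ => 1 / (n : ℝ) * C) Filter.atTop (nhds 0) := by
    simpa using (tendsto_one_div_atTop_nhds_zero_nat (𝕜 := ℝ)).mul_const C
  refine isCompactOperator_of_norm_sub_le (E := H01 α₁ α₂) (T := ι)
    (S := fun n => (cellAverageCLM n).comp ι)
    (fun n => (isCompactOperator_cellAverageCLM n).comp_clm ι) (fun n => by positivity) hlim ?_
  filter_upwards [Filter.eventually_gt_atTop 0] with n hn using h n hn

/-- An operator dominated by an interpolation inequality between a compact operator and the norm of
the source is itself compact. -/
theorem isCompactOperator_of_interpolation {E F G : Type*} [SeminormedAddCommGroup E]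
    [NormedSpace ℝ E] [NormedAddCommGroup F] [NormedSpace ℝ F] [NormedAddCommGroup G]
    [NormedSpace ℝ G] [CompleteSpace G] {S : E →L[ℝ] F} {T : E →L[ℝ] G} (hS : IsCompactOperator S)
    {s t C : ℝ} (hs : 0 < s) (ht : 0 ≤ t) (hC : 0 ≤ C)
    (h : ∀ x, ‖T x‖ ≤ ‖S x‖ ^ s * (C * ‖x‖) ^ t) : IsCompactOperator T := by
  have hSB : TotallyBounded (S '' Metric.closedBall 0 1) :=
    (hS.isCompact_closure_image_closedBall (f := S.toLinearMap) 1).totallyBounded.subset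
      subset_closure
  refine (isCompactOperator_iff_isCompact_closure_image_closedBall T.toLinearMap one_pos).2 ?_
  refine TotallyBounded.isCompact_of_isClosed (TotallyBounded.closure ?_) isClosed_closure
  refine Metric.totallyBounded_iff.2 fun ε hε => ?_
  set K : ℝ := (C * 2) ^ t with hK
  have hK0 : 0 ≤ K := by positivity
  have hεK : 0 < ε / (K + 1) := by positivity
  -- The radius `r` is chosen such that `r ^ s * K = ε * K / (K + 1) < ε`, where `K` accounts for
  -- differences of two points of the unit ball.
  obtain ⟨N, hNS, hN, hcov⟩ := Metric.finite_approx_of_totallyBounded hSB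
    ((ε / (K + 1)) ^ s⁻¹) (Real.rpow_pos_of_pos hεK _)
  choose! b hbB hb using fun y (hy : y ∈ N) => hNS hy
  refine ⟨(fun y => T (b y)) '' N, hN.image _, ?_⟩
  rintro _ ⟨x, hx, rfl⟩
  obtain ⟨y, hy, hxy⟩ := mem_iUnion₂.1 (hcov (mem_image_of_mem S hx))
  refine mem_iUnion₂.2 ⟨T (b y), mem_image_of_mem _ hy, ?_⟩
  rw [Metric.mem_ball, dist_eq_norm, ← hb y hy, ← map_sub] at hxy
  rw [mem_ball_iff_norm]
  change ‖T x - T (b y)‖ < ε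
  have h2 : ‖x - b y‖ ≤ 2 := by
    have h3 := mem_closedBall_zero_iff.1 hx
    have h4 := mem_closedBall_zero_iff.1 (hbB y hy)
    linarith [norm_sub_le x (b y)]
  rw [← map_sub]
  calc ‖T (x - b y)‖ ≤ ‖S (x - b y)‖ ^ s * (C * ‖x - b y‖) ^ t := h _
    _ ≤ ((ε / (K + 1)) ^ s⁻¹) ^ s * K := by
        rw [hK]
        gcongr
    _ = ε / (K + 1) * K := by rw [Real.rpow_inv_rpow hεK.le hs.ne']
    _ < ε := by
        rw [div_mul_eq_mul_div, div_lt_iff₀ (by positivity)]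
        nlinarith

/-- Interpolation of `L^m` between `L¹` and `L⁴`. -/
theorem eLpNorm_le_interpolation {X : Type*} [MeasurableSpace X] {μ : Measure X} {f : X → ℝ}
    (hf : AEStronglyMeasurable f μ) {m : ℝ} (h1 : 1 ≤ m) (h4 : m ≤ 4) :
    eLpNorm f (ENNReal.ofReal m) μ ≤
      eLpNorm f 1 μ ^ ((4 - m) / (3 * m)) * eLpNorm f 4 μ ^ (4 * (m - 1) / (3 * m)) := by
  have hm : 0 < m := by linarith
  -- Hölder's inequality for `|f| ^ m = |f| ^ p * (|f| ^ 4) ^ q` with `p + q = 1` and `p + 4 q = m`.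
  have hH := ENNReal.lintegral_mul_norm_pow_le hf.enorm (hf.enorm.pow_const (4 : ℝ))
    (p := (4 - m) / 3) (q := (m - 1) / 3) (by linarith) (by linarith) (by ring)
  have e (z : X) : ‖f z‖ₑ ^ ((4 - m) / 3) * (‖f z‖ₑ ^ (4 : ℝ)) ^ ((m - 1) / 3) = ‖f z‖ₑ ^ m := by
    rw [← ENNReal.rpow_mul, ← ENNReal.rpow_add_of_nonneg _ _ (by linarith) (by linarith)]
    congr 1
    ring
  simp only [e] at hH
  rw [eLpNorm_eq_lintegral_rpow_enorm_toReal (by simpa using hm) ENNReal.ofReal_ne_top,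
    eLpNorm_eq_lintegral_rpow_enorm_toReal (p := 4) (by norm_num) (by norm_num),
    eLpNorm_one_eq_lintegral_enorm, ENNReal.toReal_ofReal hm.le, ENNReal.toReal_ofNat]
  calc (∫⁻ z, ‖f z‖ₑ ^ m ∂μ) ^ (1 / m)
      ≤ ((∫⁻ z, ‖f z‖ₑ ∂μ) ^ ((4 - m) / 3) *
          (∫⁻ z, ‖f z‖ₑ ^ (4 : ℝ) ∂μ) ^ ((m - 1) / 3)) ^ (1 / m) := by gcongr
    _ = _ := by
        rw [ENNReal.mul_rpow_of_nonneg _ _ (by positivity), ← ENNReal.rpow_mul,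
          ← ENNReal.rpow_mul, ← ENNReal.rpow_mul]
        congr 2 <;> field_simp

theorem isCompactOperator_inclusion {α₁ α₂ : ℝ} (h₁ : α₁ < 1 / 2) (h₂ : α₂ < 1 / 2) {m : ℝ≥0∞}
    [hm1 : Fact (1 ≤ m)] (hm : m < 4) (ι : H01 α₁ α₂ →L[ℝ] Lp ℝ m μΩ)
    (hι : ∀ U, ι U =ᵐ[μΩ] H01.toL2 U) : IsCompactOperator ι := by
  obtain ⟨C, hC, h⟩ := exists_eLpNorm_four_le h₁.le h₂.le
  obtain ⟨ι₁, hι₁⟩ := exists_inclusion h₁.le h₂.le 1 (by norm_num)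
  have hmtop : m ≠ ⊤ := (hm.trans (by norm_num)).ne
  have hr1 : 1 ≤ m.toReal := by simpa using ENNReal.toReal_mono hmtop hm1.out
  have hr4 : m.toReal < 4 := by simpa using (ENNReal.toReal_lt_toReal hmtop (by norm_num)).2 hm
  refine isCompactOperator_of_interpolation (E := H01 α₁ α₂)
    (isCompactOperator_inclusion_one h₁ h₂ ι₁ hι₁)
    (s := (4 - m.toReal) / (3 * m.toReal)) (t := 4 * (m.toReal - 1) / (3 * m.toReal))
    (C := C.toReal) (div_pos (by linarith) (by linarith)) (div_nonneg (by linarith) (by linarith))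
    ENNReal.toReal_nonneg fun U => ?_
  have hi := eLpNorm_le_interpolation (Lp.aestronglyMeasurable (H01.toL2 U)) hr1 hr4.le
  rw [ENNReal.ofReal_toReal hmtop] at hi
  have hs : (0 : ℝ) ≤ (4 - m.toReal) / (3 * m.toReal) :=
    div_nonneg (by linarith) (by linarith)
  have ht : (0 : ℝ) ≤ 4 * (m.toReal - 1) / (3 * m.toReal) :=
    div_nonneg (by linarith) (by linarith)
  have hU : ‖ι U‖ₑ ≤ ‖ι₁ U‖ₑ ^ ((4 - m.toReal) / (3 * m.toReal)) *
      (C * ‖U‖ₑ) ^ (4 * (m.toReal - 1) / (3 * m.toReal)) := by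
    rw [Lp.enorm_def, Lp.enorm_def, eLpNorm_congr_ae (hι U), eLpNorm_congr_ae (hι₁ U)]
    refine hi.trans ?_
    gcongr
    exact h U
  have hfin : ‖ι₁ U‖ₑ ^ ((4 - m.toReal) / (3 * m.toReal)) *
      (C * ‖U‖ₑ) ^ (4 * (m.toReal - 1) / (3 * m.toReal)) ≠ ⊤ :=
    ENNReal.mul_ne_top (ENNReal.rpow_ne_top_of_nonneg hs enorm_ne_top)
      (ENNReal.rpow_ne_top_of_nonneg ht (ENNReal.mul_ne_top hC enorm_ne_top))
  simpa only [ENNReal.toReal_mul, ← ENNReal.toReal_rpow, toReal_enorm] using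
    ENNReal.toReal_mono hfin hU

end WeightedSquare

/-- For `α₁, α₂ ∈ (0, 1/2)` and `m ∈ [1, 4)`, every `u ∈ 𝓗₀¹(Ω)` lies in `L^m(Ω)`, and the
resulting inclusion map is a continuous injective compact linear operator. -/
theorem theorem202210121135 (α₁ α₂ : ℝ) (hα₁ : α₁ ∈ Set.Ioo (0 : ℝ) (1 / 2))
    (hα₂ : α₂ ∈ Set.Ioo (0 : ℝ) (1 / 2)) (m : ℝ≥0∞) [Fact (1 ≤ m)] (hm : m < 4) :
    ∃ ι : WeightedSquare.H01 α₁ α₂ →L[ℝ] Lp ℝ m WeightedSquare.μΩ,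
      (∀ U : WeightedSquare.H01 α₁ α₂,
        (ι U : ℝ × ℝ → ℝ) =ᵐ[WeightedSquare.μΩ] WeightedSquare.H01.toL2 U) ∧
      Function.Injective ι ∧ IsCompactOperator ι := by
  obtain ⟨ι, hι⟩ := WeightedSquare.exists_inclusion hα₁.2.le hα₂.2.le m hm.le
  refine ⟨ι, hι, fun U V hUV => ?_,
    WeightedSquare.isCompactOperator_inclusion hα₁.2 hα₂.2 hm ι hι⟩
  refine Subtype.ext (WeightedSquare.H1.toL2_injective (Lp.ext ?_))
  have hU := hι U
  rw [hUV] at hU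
  exact hU.symm.trans (hι V)
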